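/- Let $k$ be an algebraically closed field of characteristic zero. For $n\ge 1$, let $\mathcal A_s(n)$ be the Hopf algebra over $k$ generated as an algebra by $u_{ij}$ ($1\le i,j\le n$) with relations $$u_{ij}u_{il}=\delta_{jl}u_{ij},\quad u_{ij}u_{lj}=\delta_{il}u_{ij},\quad \sum_{l}u_{il}=1=\sum_l u_{lj},$$ and with $\Delta(u_{ij})=\sum_l u_{il}\otimes u_{lj}$, $\varepsilon(u_{ij})=\delta_{ij}$, $\mathcal S(u_{ij})=u_{ji}$. A Hopf algebra $H$ is a *quantum permutation algebra* if it is a quotient Hopf algebra of $\mathcal A_s(n)$ (that is, there is a surjective Hopf algebra map $\mathcal A_s(n)\to H$) for some $n\ge 1$; its *degree* $d(H)$ is then the smallest such $n$. Let $(F,\Gamma)$ be a matched pair of finite groups, that is, finite groups with a left action $\vartriangleright$ of $\Gamma$ on the set $F$ and a right action $\vartriangleleft$ of $F$ on the set $\Gamma$ such that $$s\vartriangleright xy=(s\vartriangleright x)\big((s\vartriangleleft x)\vartriangleright y\big),\qquad st\vartriangleleft x=\big(s\vartriangleleft(t\vartriangleright x)\big)(t\vartriangleleft x)$$ for all $s,t\in\Gamma$,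 $x,y\in F$. Let $\sigma:F\times F\to(k^\times)^\Gamma$ and $\tau:\Gamma\times\Gamma\to(k^\times)^F$ be normalized 2-cocycles for the induced actions, and write $\sigma_s(x,y)=\sigma(x,y)(s)$, $\tau_x(s,t)=\tau(s,t)(x)$. Thus, for all $s,t,r\in\Gamma$ and $x,y,z\in F$, $\sigma_s(1,x)=\sigma_s(x,1)=1=\tau_x(1,s)=\tau_x(s,1)$ and $$\sigma_{s\vartriangleleft x}(y,z)\,\sigma_s(x,yz)=\sigma_s(x,y)\,\sigma_s(xy,z),\qquad \tau_x(st,r)\,\tau_{r\vartriangleright x}(s,t)=\tau_x(s,tr)\,\tau_x(t,r).$$ Assume moreover that $\sigma$ and $\tau$ are compatible: $$\sigma_{st}(x,y)\,\tau_{xy}(s,t)=\tau_x(s,t)\,\tau_y\big(s\vartriangleleft(t\vartriangleright x),\,t\vartriangleleft x\big)\,\sigma_s\big(t\vartriangleright x,\,(t\vartriangleleft x)\vartriangleright y\big)\,\sigma_t(x,y).$$ Let $H=k^\Gamma\,{}^{\tau}\#_{\sigma}kF$ be the associated bicrossed product: the Hopf algebra with $k$-basis $e_g\#x$ ($g\in\Gamma$,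 $x\in F$), unit $\sum_{g\in\Gamma} e_g\#1$, counit $\varepsilon(e_g\#x)=\delta_{g,1}$, and $$(e_g\#x)(e_h\#y)=\delta_{g\vartriangleleft x,\,h}\,\sigma_g(x,y)\,e_g\#xy,\qquad \Delta(e_g\#x)=\sum_{st=g}\tau_x(s,t)\,e_s\#(t\vartriangleright x)\otimes e_t\#x .$$ Suppose that the subalgebra $k^\Gamma=\operatorname{span}\{e_g\#1: g\in\Gamma\}$ is central in $H$. Then $H$ is a quantum permutation algebra, and $d(H)\le|\Gamma|\,|F|^2$. -/

import Mathlib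

open scoped TensorProduct

noncomputable section

/-! ### The quantum permutation algebra on `n` points -/

section Magic

/-- The defining relations of the quantum permutation algebra: the generators
`u i j` form a magic matrix. -/
inductive MagicRel (k : Type*) [Field k] (n : ℕ) :
    FreeAlgebra k (Fin n × Fin n) → FreeAlgebra k (Fin n × Fin n) → Prop
  | row_mul (i j l : Fin n) : MagicRel k n
      (FreeAlgebra.ι k (i, j) * FreeAlgebra.ι k (i, l))
      (if j = l then FreeAlgebra.ι k (i, j) else 0)
  | col_mul (i j l : Fin n) : MagicRel k n
      (FreeAlgebra.ι k (i, j) * FreeAlgebra.ι k (l, j))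
      (if i = l then FreeAlgebra.ι k (i, j) else 0)
  | row_sum (i : Fin n) : MagicRel k n (∑ l, FreeAlgebra.ι k (i, l)) 1
  | col_sum (j : Fin n) : MagicRel k n (∑ l, FreeAlgebra.ι k (l, j)) 1

/-- Wang's algebra `A_s(n)`: the `k`-algebra presented by generators `u i j`
(`1 ≤ i, j ≤ n`) subject to the relations of a magic matrix. -/
def QuantumPerm (k : Type*) [Field k] (n : ℕ) : Type _ := RingQuot (MagicRel k n)

namespace QuantumPerm

variable {k : Type*} [Field k] {n : ℕ}

instance : Ring (QuantumPerm k n) := inferInstanceAs (Ring (RingQuot (MagicRel k n)))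

instance : Algebra k (QuantumPerm k n) :=
  inferInstanceAs (Algebra k (RingQuot (MagicRel k n)))

/-- The generator `u i j`. -/
def u (i j : Fin n) : QuantumPerm k n :=
  RingQuot.mkAlgHom k (MagicRel k n) (FreeAlgebra.ι k (i, j))

theorem u_row_mul (i j l : Fin n) :
    (u i j * u i l : QuantumPerm k n) = if j = l then u i j else 0 := by
  have h := RingQuot.mkAlgHom_rel k (MagicRel.row_mul (k := k) i j l)
  rw [map_mul] at h
  refine h.trans ?_
  split_ifs
  · rfl
  · exact map_zero _

theorem u_col_mul (i j l : Fin n) :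
    (u i j * u l j : QuantumPerm k n) = if i = l then u i j else 0 := by
  have h := RingQuot.mkAlgHom_rel k (MagicRel.col_mul (k := k) i j l)
  rw [map_mul] at h
  refine h.trans ?_
  split_ifs
  · rfl
  · exact map_zero _

theorem u_row_sum (i : Fin n) : (∑ l, u i l : QuantumPerm k n) = 1 := by
  have h := RingQuot.mkAlgHom_rel k (MagicRel.row_sum (k := k) i)
  rw [map_sum, map_one] at h
  exact h

theorem u_col_sum (j : Fin n) : (∑ l, u l j : QuantumPerm k n) = 1 := by
  have h := RingQuot.mkAlgHom_rel k (MagicRel.col_sum (k := k) j)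
  rw [map_sum, map_one] at h
  exact h

/-- The universal property: a magic matrix with entries in `B` gives an algebra map. -/
def lift {B : Type*} [Ring B] [Algebra k B] (v : Fin n → Fin n → B)
    (h1 : ∀ i j l, v i j * v i l = if j = l then v i j else 0)
    (h2 : ∀ i j l, v i j * v l j = if i = l then v i j else 0)
    (h3 : ∀ i, ∑ l, v i l = 1) (h4 : ∀ j, ∑ l, v l j = 1) :
    QuantumPerm k n →ₐ[k] B :=
  RingQuot.liftAlgHom k (s := MagicRel k n)
    ⟨FreeAlgebra.lift k (fun p : Fin n × Fin n => v p.1 p.2), by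
      intro a b hab
      cases hab with
      | row_mul i j l =>
        have := h1 i j l
        split_ifs at this ⊢ <;> simpa using this
      | col_mul i j l =>
        have := h2 i j l
        split_ifs at this ⊢ <;> simpa using this
      | row_sum i => simpa using h3 i
      | col_sum j => simpa using h4 j⟩

@[simp]
theorem lift_u {B : Type*} [Ring B] [Algebra k B] (v : Fin n → Fin n → B)
    (h1 : ∀ i j l, v i j * v i l = if j = l then v i j else 0)
    (h2 : ∀ i j l, v i j * v l j = if i = l then v i j else 0)
    (h3 : ∀ i, ∑ l, v i l = 1) (h4 : ∀ j, ∑ l, v l j = 1) (i j : Fin n) :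
    lift v h1 h2 h3 h4 (u i j : QuantumPerm k n) = v i j := by
  refine (RingQuot.liftAlgHom_mkAlgHom_apply k (s := MagicRel k n) _ _ _).trans ?_
  exact FreeAlgebra.lift_ι_apply _ _

theorem algHom_ext {B : Type*} [Ring B] [Algebra k B] {f g : QuantumPerm k n →ₐ[k] B}
    (h : ∀ i j, f (u i j) = g (u i j)) : f = g := by
  refine RingQuot.ringQuot_ext' k (s := MagicRel k n) f g ?_
  refine FreeAlgebra.hom_ext ?_
  funext p
  exact h p.1 p.2

/-- An induction principle: a property holding for the generators and the scalars and
stable under sums and products holds everywhere. -/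
theorem induct {P : QuantumPerm k n → Prop} (halg : ∀ r : k, P (algebraMap k _ r))
    (hu : ∀ i j, P (u i j)) (hadd : ∀ a b, P a → P b → P (a + b))
    (hmul : ∀ a b, P a → P b → P (a * b)) (a : QuantumPerm k n) : P a := by
  obtain ⟨b, rfl⟩ := RingQuot.mkAlgHom_surjective k (MagicRel k n) a
  induction b using FreeAlgebra.induction with
  | grade0 r =>
    have h : RingQuot.mkAlgHom k (MagicRel k n) (algebraMap k _ r) =
      algebraMap k (QuantumPerm k n) r := AlgHom.commutes _ r
    rw [h]
    exact halg r
  | grade1 p => exact hu p.1 p.2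
  | mul a b ha hb =>
    rw [map_mul]
    exact hmul _ _ ha hb
  | add a b ha hb =>
    rw [map_add]
    exact hadd _ _ ha hb

/-- The comultiplication `Δ (u i j) = ∑ l, u i l ⊗ u l j`. -/
def comulHom : QuantumPerm k n →ₐ[k] QuantumPerm k n ⊗[k] QuantumPerm k n :=
  lift (fun i j => ∑ l, u i l ⊗ₜ[k] u l j)
    (by
      intro i j l
      simp only [Finset.sum_mul, Finset.mul_sum, Algebra.TensorProduct.tmul_mul_tmul,
        u_row_mul, TensorProduct.ite_tmul]
      simp only [Finset.sum_ite_eq', Finset.mem_univ, if_true, u_row_mul, TensorProduct.tmul_ite]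
      split_ifs <;> simp)
    (by
      intro i j l
      simp only [Finset.sum_mul, Finset.mul_sum, Algebra.TensorProduct.tmul_mul_tmul,
        u_col_mul, TensorProduct.tmul_ite]
      simp only [Finset.sum_ite_eq', Finset.mem_univ, if_true, u_col_mul, TensorProduct.ite_tmul]
      split_ifs <;> simp)
    (by
      intro i
      rw [Finset.sum_comm]
      simp only [← TensorProduct.tmul_sum, u_row_sum, ← TensorProduct.sum_tmul]
      rfl)
    (by
      intro j
      rw [Finset.sum_comm]
      simp only [← TensorProduct.tmul_sum, u_col_sum, ← TensorProduct.sum_tmul]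
      rfl)

/-- The counit `ε (u i j) = δ i j`. -/
def counitHom : QuantumPerm k n →ₐ[k] k :=
  lift (fun i j => if i = j then 1 else 0)
    (by intro i j l; split_ifs <;> simp_all)
    (by intro i j l; split_ifs <;> simp_all)
    (by intro i; simp) (by intro j; simp)

/-- The antipode `S (u i j) = u j i`, as an algebra map to the opposite algebra. -/
def antipodeHom : QuantumPerm k n →ₐ[k] (QuantumPerm k n)ᵐᵒᵖ :=
  lift (fun i j => MulOpposite.op (u j i))
    (by
      intro i j l
      rw [← MulOpposite.op_mul, u_col_mul]
      split_ifs <;> simp_all)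
    (by
      intro i j l
      rw [← MulOpposite.op_mul, u_row_mul]
      split_ifs <;> simp_all)
    (by intro i; rw [← Finset.op_sum, u_col_sum]; rfl)
    (by intro i; rw [← Finset.op_sum, u_row_sum]; rfl)

@[simp]
theorem comulHom_u (i j : Fin n) :
    comulHom (u i j : QuantumPerm k n) = ∑ l, u i l ⊗ₜ[k] u l j := lift_u _ _ _ _ _ i j

@[simp]
theorem counitHom_u (i j : Fin n) :
    counitHom (u i j : QuantumPerm k n) = if i = j then 1 else 0 := lift_u _ _ _ _ _ i j

@[simp]
theorem antipodeHom_u (i j : Fin n) :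
    antipodeHom (u i j : QuantumPerm k n) = MulOpposite.op (u j i) := lift_u _ _ _ _ _ i j

instance : Bialgebra k (QuantumPerm k n) :=
  Bialgebra.ofAlgHom comulHom counitHom
    (by
      refine algHom_ext fun i j => ?_
      simp only [AlgHom.comp_apply, comulHom_u, map_sum, Algebra.TensorProduct.map_tmul,
        AlgHom.id_apply, TensorProduct.sum_tmul, TensorProduct.tmul_sum]
      exact Finset.sum_comm)
    (by
      refine algHom_ext fun i j => ?_
      simp [TensorProduct.ite_tmul])
    (by
      refine algHom_ext fun i j => ?_
      simp [TensorProduct.tmul_ite])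

/-- The antipode `S (u i j) = u j i`, as a linear map. -/
def antipodeLin : QuantumPerm k n →ₗ[k] QuantumPerm k n :=
  (MulOpposite.opLinearEquiv k).symm.toLinearMap ∘ₗ antipodeHom.toLinearMap

theorem antipodeLin_mul (a b : QuantumPerm k n) :
    antipodeLin (a * b) = antipodeLin b * antipodeLin a := by
  simp [antipodeLin]

@[simp]
theorem antipodeLin_u (i j : Fin n) : antipodeLin (u i j : QuantumPerm k n) = u j i := by
  simp [antipodeLin]

theorem antipodeLin_algebraMap (r : k) :
    antipodeLin (algebraMap k (QuantumPerm k n) r) = algebraMap k _ r := by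
  simp [antipodeLin]

theorem antipode_left (a : QuantumPerm k n) :
    LinearMap.mul' k _ (antipodeLin.rTensor _ (comulHom a)) =
      algebraMap k (QuantumPerm k n) (counitHom a) := by
  induction a using induct with
  | halg r =>
    rw [AlgHom.commutes, AlgHom.commutes, Algebra.TensorProduct.algebraMap_apply,
      LinearMap.rTensor_tmul, antipodeLin_algebraMap]
    simp
  | hu i j =>
    simp only [comulHom_u, map_sum, LinearMap.rTensor_tmul, antipodeLin_u,
      LinearMap.mul'_apply, u_row_mul, counitHom_u]
    split_ifs with h
    · simp [u_col_sum]
    · simp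
  | hadd a b ha hb => simp only [map_add, ha, hb]
  | hmul a b ha hb =>
    have key : ∀ s t : QuantumPerm k n ⊗[k] QuantumPerm k n, ∀ r : k,
        LinearMap.mul' k _ (antipodeLin.rTensor _ s) = algebraMap k _ r →
        LinearMap.mul' k _ (antipodeLin.rTensor _ (s * t)) =
          r • LinearMap.mul' k _ (antipodeLin.rTensor _ t) := by
      intro s t r hs
      induction t using TensorProduct.induction_on with
      | zero => simp
      | add x y hx hy => simp only [mul_add, map_add, hx, hy, smul_add]
      | tmul x y =>
        have : ∀ s : QuantumPerm k n ⊗[k] QuantumPerm k n,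
            LinearMap.mul' k _ (antipodeLin.rTensor _ (s * x ⊗ₜ[k] y)) =
              antipodeLin x * LinearMap.mul' k _ (antipodeLin.rTensor _ s) * y := by
          intro s
          induction s using TensorProduct.induction_on with
          | zero => simp
          | add p q hp hq => simp only [add_mul, map_add, hp, hq, mul_add]
          | tmul p q => simp [antipodeLin_mul, mul_assoc]
        rw [this, hs, LinearMap.rTensor_tmul, LinearMap.mul'_apply, ← Algebra.commutes,
          mul_assoc, Algebra.smul_def]
    rw [map_mul, key _ _ _ ha, hb, map_mul, map_mul, Algebra.smul_def]

theorem antipode_right (a : QuantumPerm k n) :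
    LinearMap.mul' k _ (antipodeLin.lTensor _ (comulHom a)) =
      algebraMap k (QuantumPerm k n) (counitHom a) := by
  induction a using induct with
  | halg r =>
    rw [AlgHom.commutes, AlgHom.commutes, Algebra.TensorProduct.algebraMap_apply,
      LinearMap.lTensor_tmul, ← map_one (algebraMap k (QuantumPerm k n)), antipodeLin_algebraMap]
    simp
  | hu i j =>
    simp only [comulHom_u, map_sum, LinearMap.lTensor_tmul, antipodeLin_u,
      LinearMap.mul'_apply, u_col_mul, counitHom_u]
    split_ifs with h
    · simp [u_row_sum]
    · simp
  | hadd a b ha hb => simp only [map_add, ha, hb]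
  | hmul a b ha hb =>
    have key : ∀ s t : QuantumPerm k n ⊗[k] QuantumPerm k n, ∀ r : k,
        LinearMap.mul' k _ (antipodeLin.lTensor _ t) = algebraMap k _ r →
        LinearMap.mul' k _ (antipodeLin.lTensor _ (s * t)) =
          r • LinearMap.mul' k _ (antipodeLin.lTensor _ s) := by
      intro s t r ht
      induction s using TensorProduct.induction_on with
      | zero => simp
      | add x y hx hy => simp only [add_mul, map_add, hx, hy, smul_add]
      | tmul x y =>
        have : ∀ t : QuantumPerm k n ⊗[k] QuantumPerm k n,
            LinearMap.mul' k _ (antipodeLin.lTensor _ (x ⊗ₜ[k] y * t)) =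
              x * LinearMap.mul' k _ (antipodeLin.lTensor _ t) * antipodeLin y := by
          intro t
          induction t using TensorProduct.induction_on with
          | zero => simp
          | add p q hp hq => simp only [mul_add, map_add, hp, hq, add_mul]
          | tmul p q => simp [antipodeLin_mul, mul_assoc]
        rw [this, ht, LinearMap.lTensor_tmul, LinearMap.mul'_apply, ← Algebra.commutes,
          mul_assoc, Algebra.smul_def]
    rw [map_mul, key _ _ _ hb, ha, map_mul, map_mul, Algebra.smul_def, ← Algebra.commutes]

instance : HopfAlgebra k (QuantumPerm k n) where
  antipode := antipodeLin
  mul_antipode_rTensor_comul := LinearMap.ext fun a => antipode_left a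
  mul_antipode_lTensor_comul := LinearMap.ext fun a => antipode_right a

end QuantumPerm

/-- `H` is a quotient Hopf algebra of `A_s(n)`: there is a surjective Hopf algebra map
from `A_s(n)` to `H`. -/
def IsQuantumPermQuotient (k : Type*) (H : Type*) [Field k] [Ring H] [HopfAlgebra k H]
    (n : ℕ) : Prop :=
  ∃ f : QuantumPerm k n →ₐc[k] H, Function.Surjective f ∧
    ∀ a, f (HopfAlgebra.antipode k a) = HopfAlgebra.antipode k (f a)

/-- A quantum permutation algebra is a Hopf algebra that is a quotient Hopf algebra of
`A_s(n)` for some `n ≥ 1`. -/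
def IsQuantumPermutationAlgebra (k : Type*) (H : Type*) [Field k] [Ring H]
    [HopfAlgebra k H] : Prop :=
  ∃ n : ℕ, 1 ≤ n ∧ IsQuantumPermQuotient k H n

/-- The degree of a quantum permutation algebra: the smallest `n ≥ 1` such that `H` is a
quotient Hopf algebra of `A_s(n)`. -/
def quantumDegree (k : Type*) (H : Type*) [Field k] [Ring H] [HopfAlgebra k H] : ℕ :=
  sInf {n : ℕ | 1 ≤ n ∧ IsQuantumPermQuotient k H n}

end Magic

/-! ### Matched pairs and bicrossed products -/

section Bicrossed

/-- A matched pair of groups `(F, Γ)`: a left action `act s x = s ▷ x` of `Γ` on the set `F`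
and a right action `ract s x = s ◁ x` of `F` on the set `Γ` such that
`s ▷ (x y) = (s ▷ x) ((s ◁ x) ▷ y)` and `(s t) ◁ x = (s ◁ (t ▷ x)) (t ◁ x)`. -/
structure MatchedPair (F Γ : Type*) [Group F] [Group Γ] where
  /-- `s ▷ x` -/
  act : Γ → F → F
  /-- `s ◁ x` -/
  ract : Γ → F → Γ
  one_act : ∀ x, act 1 x = x
  mul_act : ∀ s t x, act (s * t) x = act s (act t x)
  ract_one : ∀ s, ract s 1 = s
  ract_mul : ∀ s x y, ract s (x * y) = ract (ract s x) y
  act_mul : ∀ s x y, act s (x * y) = act s x * act (ract s x) y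
  mul_ract : ∀ s t x, ract (s * t) x = ract s (act t x) * ract t x

/-- The data of a bicrossed product `k^Γ #_{σ,τ} kF`: a matched pair `(F, Γ)`, a normalized
2-cocycle `σ : F × F → (kˣ)^Γ` for the left action `(x . f) (g) = f (g ◁ x)` of `F` on `(kˣ)^Γ`,
a normalized 2-cocycle `τ : Γ × Γ → (kˣ)^F` for the right action `(w . g) (x) = w (g ▷ x)`
of `Γ` on `(kˣ)^F`, and the compatibility between the two (multiplicativity of `Δ`).
Here `σ x y g` is `σ_g(x, y)` and `τ s t x` is `τ_x(s, t)`. -/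
structure BicrossedData (k F Γ : Type*) [Field k] [Group F] [Group Γ] extends
    MatchedPair F Γ where
  /-- `σ x y g = σ_g(x, y)` -/
  σ : F → F → Γ → kˣ
  /-- `τ s t x = τ_x(s, t)` -/
  τ : Γ → Γ → F → kˣ
  σ_one_left : ∀ x g, σ 1 x g = 1
  σ_one_right : ∀ x g, σ x 1 g = 1
  σ_cocycle : ∀ x y z g, σ y z (ract g x) * σ x (y * z) g = σ x y g * σ (x * y) z g
  τ_one_left : ∀ s x, τ 1 s x = 1
  τ_one_right : ∀ s x, τ s 1 x = 1
  τ_cocycle : ∀ s t r x, τ (s * t) r x * τ s t (act r x) = τ s (t * r) x * τ t r x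
  compat : ∀ s t x y, σ x y (s * t) * τ s t (x * y) =
    τ s t x * τ (ract s (act t x)) (ract t x) y *
      (σ (act t x) (act (ract t x) y) s * σ x y t)

namespace MatchedPair

variable {F Γ : Type*} [Group F] [Group Γ] (M : MatchedPair F Γ)

theorem one_ract (x : F) : M.ract 1 x = 1 := by
  have h := M.mul_ract 1 1 x
  rw [M.one_act, mul_one] at h
  exact mul_eq_left.mp h.symm

theorem act_one (s : Γ) : M.act s 1 = 1 := by
  have h := M.act_mul s 1 1
  rw [M.ract_one, mul_one] at h
  exact mul_eq_left.mp h.symm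

theorem ract_injective (x : F) : Function.Injective fun s => M.ract s x := by
  intro s t h
  have h2 := congrArg (fun r => M.ract r x⁻¹) h
  simpa only [← M.ract_mul, mul_inv_cancel, M.ract_one] using h2

theorem inv_act_act (s : Γ) (x : F) : M.act s⁻¹ (M.act s x) = x := by
  rw [← M.mul_act, inv_mul_cancel, M.one_act]

theorem act_inv_act (s : Γ) (x : F) : M.act s (M.act s⁻¹ x) = x := by
  rw [← M.mul_act, mul_inv_cancel, M.one_act]

theorem inv_ract_eq (s : Γ) (x : F) : (M.ract s x)⁻¹ = M.ract s⁻¹ (M.act s x) := by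
  have h := M.mul_ract s⁻¹ s x
  rw [inv_mul_cancel, M.one_ract] at h
  exact (eq_inv_of_mul_eq_one_left h.symm).symm

theorem inv_act_eq (s : Γ) (x : F) : (M.act s x)⁻¹ = M.act (M.ract s x) x⁻¹ := by
  have h := M.act_mul s x x⁻¹
  rw [mul_inv_cancel, M.act_one] at h
  exact (eq_inv_of_mul_eq_one_right h.symm).symm

end MatchedPair

namespace BicrossedData

variable {k F Γ : Type*} [Field k] [Group F] [Group Γ] (D : BicrossedData k F Γ)

theorem σ_at_one (x y : F) : D.σ x y 1 = 1 := by
  have h := D.compat 1 1 x y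
  simp only [mul_one, D.τ_one_left, D.one_act, D.one_ract, one_mul] at h
  exact mul_eq_left.mp h.symm

theorem τ_at_one (s t : Γ) : D.τ s t 1 = 1 := by
  have h := D.compat s t 1 1
  simp only [mul_one, D.σ_one_left, D.act_one, D.ract_one, one_mul] at h
  exact mul_eq_left.mp h.symm

/-- The underlying vector space `k^Γ ⊗ kF` of the bicrossed product, realized as the
`k`-vector space with basis `e_g # x`, `(g, x) ∈ Γ × F`. -/
def BicrossedProduct (_D : BicrossedData k F Γ) : Type _ := (Γ × F) →₀ k

instance : AddCommGroup D.BicrossedProduct := inferInstanceAs (AddCommGroup ((Γ × F) →₀ k))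

instance : Module k D.BicrossedProduct := inferInstanceAs (Module k ((Γ × F) →₀ k))

/-- The basis `e_g # x` of the bicrossed product. -/
def basis : Module.Basis (Γ × F) k D.BicrossedProduct :=
  Module.Basis.ofRepr (LinearEquiv.refl k ((Γ × F) →₀ k))

/-- The basis element `e_g # x`. -/
def e (g : Γ) (x : F) : D.BicrossedProduct := D.basis (g, x)

theorem lin_ext {V : Type*} [AddCommMonoid V] [Module k V]
    {f f' : D.BicrossedProduct →ₗ[k] V} (h : ∀ g x, f (D.e g x) = f' (D.e g x)) : f = f' :=
  D.basis.ext fun p => h p.1 p.2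

open Classical in
/-- The multiplication
`(e_g # x) (e_h # y) = δ_{g ◁ x, h} σ_g(x, y) e_g # x y`, as a bilinear map. -/
def mulLin : D.BicrossedProduct →ₗ[k] D.BicrossedProduct →ₗ[k] D.BicrossedProduct :=
  D.basis.constr k fun p => D.basis.constr k fun q =>
    if D.ract p.1 p.2 = q.1 then (D.σ p.2 q.2 p.1 : k) • D.e p.1 (p.2 * q.2) else 0

open Classical in
theorem mulLin_e (g h : Γ) (x y : F) : D.mulLin (D.e g x) (D.e h y) =
    if D.ract g x = h then (D.σ x y g : k) • D.e g (x * y) else 0 := by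
  simp only [mulLin, e, Module.Basis.constr_basis]

open Classical in
/-- The counit `ε (e_g # x) = δ_{g, 1}`. -/
def counitLin : D.BicrossedProduct →ₗ[k] k :=
  D.basis.constr k fun p => if p.1 = 1 then 1 else 0

open Classical in
theorem counitLin_e (g : Γ) (x : F) : D.counitLin (D.e g x) = if g = 1 then 1 else 0 := by
  simp only [counitLin, e, Module.Basis.constr_basis]

/-- The antipode
`S (e_g # x) = σ_{(g ◁ x)⁻¹}((g ▷ x)⁻¹, g ▷ x)⁻¹ τ_x(g⁻¹, g)⁻¹ e_{(g ◁ x)⁻¹} # (g ▷ x)⁻¹`. -/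
def antipodeLin : D.BicrossedProduct →ₗ[k] D.BicrossedProduct :=
  D.basis.constr k fun p =>
    (((D.σ (D.act p.1 p.2)⁻¹ (D.act p.1 p.2) (D.ract p.1 p.2)⁻¹)⁻¹ *
      (D.τ p.1⁻¹ p.1 p.2)⁻¹ : kˣ) : k) • D.e (D.ract p.1 p.2)⁻¹ (D.act p.1 p.2)⁻¹

theorem antipodeLin_e (g : Γ) (x : F) : D.antipodeLin (D.e g x) =
    (((D.σ (D.act g x)⁻¹ (D.act g x) (D.ract g x)⁻¹)⁻¹ *
      (D.τ g⁻¹ g x)⁻¹ : kˣ) : k) • D.e (D.ract g x)⁻¹ (D.act g x)⁻¹ := by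
  simp only [antipodeLin, e, Module.Basis.constr_basis]

theorem mulLin_assoc (a b c : D.BicrossedProduct) :
    D.mulLin (D.mulLin a b) c = D.mulLin a (D.mulLin b c) := by
  classical
  have h : D.mulLin.compr₂ D.mulLin =
      (LinearMap.llcomp k _ _ _ ∘ₗ D.mulLin).compl₂ D.mulLin := by
    refine D.lin_ext fun g x => D.lin_ext fun h y => D.lin_ext fun l z => ?_
    simp only [LinearMap.compr₂_apply, LinearMap.compl₂_apply, LinearMap.comp_apply,
      LinearMap.llcomp_apply, mulLin_e]
    by_cases h1 : D.ract g x = h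
    · subst h1
      rw [if_pos rfl, map_smul, LinearMap.smul_apply, mulLin_e, D.ract_mul]
      split_ifs with h2
      · rw [map_smul, mulLin_e, if_pos rfl, smul_smul, smul_smul, mul_assoc]
        congr 1
        exact_mod_cast (D.σ_cocycle x y z g).symm
      · simp
    · rw [if_neg h1]
      split_ifs with h2
      · rw [map_smul, mulLin_e, if_neg h1]
        simp
      · simp
  exact LinearMap.congr_fun (LinearMap.congr_fun (LinearMap.congr_fun h a) b) c

theorem τ_inv (s : Γ) (x : F) : D.τ s s⁻¹ (D.act s x) = D.τ s⁻¹ s x := by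
  have h := D.τ_cocycle s s⁻¹ s x
  simpa only [mul_inv_cancel, inv_mul_cancel, D.τ_one_left, D.τ_one_right, one_mul] using h

theorem σ_inv (x : F) (g : Γ) : D.σ x⁻¹ x (D.ract g x) = D.σ x x⁻¹ g := by
  have h := D.σ_cocycle x x⁻¹ x g
  simpa only [mul_inv_cancel, inv_mul_cancel, D.σ_one_left, D.σ_one_right, one_mul,
    mul_one] using h

variable [Fintype Γ]

/-- The comultiplication
`Δ (e_g # x) = ∑_{s t = g} τ_x(s, t) (e_s # (t ▷ x)) ⊗ (e_t # x)`; the sum is over `s`, with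
`t = s⁻¹ g`. -/
def comulLin : D.BicrossedProduct →ₗ[k] D.BicrossedProduct ⊗[k] D.BicrossedProduct :=
  D.basis.constr k fun p => ∑ s : Γ, (D.τ s (s⁻¹ * p.1) p.2 : k) •
    (D.e s (D.act (s⁻¹ * p.1) p.2) ⊗ₜ[k] D.e (s⁻¹ * p.1) p.2)

theorem comulLin_e (g : Γ) (x : F) : D.comulLin (D.e g x) =
    ∑ s : Γ, (D.τ s (s⁻¹ * g) x : k) •
      (D.e s (D.act (s⁻¹ * g) x) ⊗ₜ[k] D.e (s⁻¹ * g) x) := by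
  simp only [comulLin, e, Module.Basis.constr_basis]

/-- The unit `1 = ∑_g e_g # 1`. -/
def unit : D.BicrossedProduct := ∑ g : Γ, D.e g 1

theorem unit_mulLin (a : D.BicrossedProduct) : D.mulLin D.unit a = a := by
  classical
  have h : D.mulLin D.unit = LinearMap.id := by
    refine D.lin_ext fun g x => ?_
    simp only [unit, map_sum, LinearMap.sum_apply, mulLin_e, D.ract_one, Finset.sum_ite_eq',
      Finset.mem_univ, if_true, D.σ_one_left, one_mul, Units.val_one, one_smul, LinearMap.id_apply]
  exact LinearMap.congr_fun h a

theorem mulLin_unit (a : D.BicrossedProduct) : D.mulLin a D.unit = a := by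
  classical
  have h : D.mulLin.flip D.unit = LinearMap.id := by
    refine D.lin_ext fun g x => ?_
    rw [LinearMap.flip_apply]
    simp only [unit, map_sum, mulLin_e, Finset.sum_ite_eq,
      Finset.mem_univ, if_true, D.σ_one_right, mul_one, Units.val_one, one_smul,
      LinearMap.id_apply]
  exact LinearMap.congr_fun h a

instance : Ring D.BicrossedProduct where
  __ := (inferInstance : AddCommGroup D.BicrossedProduct)
  mul a b := D.mulLin a b
  one := D.unit
  left_distrib a b c := map_add (D.mulLin a) b c
  right_distrib a b c := by
    change D.mulLin (a + b) c = D.mulLin a c + D.mulLin b c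
    rw [map_add, LinearMap.add_apply]
  zero_mul a := by
    change D.mulLin 0 a = 0
    rw [map_zero, LinearMap.zero_apply]
  mul_zero a := map_zero (D.mulLin a)
  mul_assoc a b c := D.mulLin_assoc a b c
  one_mul a := D.unit_mulLin a
  mul_one a := D.mulLin_unit a

theorem mul_def (a b : D.BicrossedProduct) : a * b = D.mulLin a b := rfl

theorem one_def : (1 : D.BicrossedProduct) = ∑ g : Γ, D.e g 1 := rfl

open Classical in
theorem e_mul_e (g h : Γ) (x y : F) : D.e g x * D.e h y =
    if D.ract g x = h then (D.σ x y g : k) • D.e g (x * y) else 0 := D.mulLin_e g h x y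

instance : Algebra k D.BicrossedProduct :=
  Algebra.ofModule
    (fun r a b => by rw [mul_def, mul_def, map_smul, LinearMap.smul_apply])
    (fun r a b => by rw [mul_def, mul_def, map_smul])

instance : Coalgebra k D.BicrossedProduct where
  comul := D.comulLin
  counit := D.counitLin
  coassoc := by
    refine D.lin_ext fun g x => ?_
    simp only [LinearMap.comp_apply, comulLin_e, map_sum, map_smul, LinearMap.rTensor_tmul,
      LinearMap.lTensor_tmul, LinearEquiv.coe_coe, TensorProduct.sum_tmul,
      TensorProduct.tmul_sum, ← TensorProduct.smul_tmul', TensorProduct.tmul_smul,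
      TensorProduct.assoc_tmul, Finset.smul_sum, smul_smul]
    rw [Finset.sum_comm]
    refine Finset.sum_congr rfl fun a _ => ?_
    refine Fintype.sum_equiv (Equiv.mulLeft a⁻¹) _ _ fun s => ?_
    have e1 : (a⁻¹ * s)⁻¹ * (a⁻¹ * g) = s⁻¹ * g := by group
    have e2 : D.act (a⁻¹ * s) (D.act (s⁻¹ * g) x) = D.act (a⁻¹ * g) x := by
      rw [← D.mul_act]
      congr 1
      group
    simp only [Equiv.coe_mulLeft, e1, e2]
    have h := D.τ_cocycle a (a⁻¹ * s) (s⁻¹ * g) x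
    rw [show a * (a⁻¹ * s) = s by group, show a⁻¹ * s * (s⁻¹ * g) = a⁻¹ * g by group] at h
    congr 1
    exact_mod_cast h
  rTensor_counit_comp_comul := by
    classical
    refine D.lin_ext fun g x => ?_
    simp only [LinearMap.comp_apply, comulLin_e, map_sum, map_smul, LinearMap.rTensor_tmul,
      counitLin_e, TensorProduct.ite_tmul, smul_ite, smul_zero, Finset.sum_ite_eq',
      Finset.mem_univ, if_true, inv_one, one_mul, D.τ_one_left, Units.val_one, one_smul,
      TensorProduct.mk_apply]
  lTensor_counit_comp_comul := by
    classical
    refine D.lin_ext fun g x => ?_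
    simp only [LinearMap.comp_apply, comulLin_e, map_sum, map_smul, LinearMap.lTensor_tmul,
      counitLin_e, TensorProduct.tmul_ite, smul_ite, smul_zero, inv_mul_eq_one, Finset.sum_ite_eq',
      Finset.mem_univ, if_true, inv_mul_cancel, D.τ_one_right, D.one_act, Units.val_one, one_smul,
      LinearMap.flip_apply, TensorProduct.mk_apply]

theorem comul_e (g : Γ) (x : F) : Coalgebra.comul (R := k) (D.e g x) =
    ∑ s : Γ, (D.τ s (s⁻¹ * g) x : k) •
      (D.e s (D.act (s⁻¹ * g) x) ⊗ₜ[k] D.e (s⁻¹ * g) x) := D.comulLin_e g x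

open Classical in
theorem counit_e (g : Γ) (x : F) :
    Coalgebra.counit (R := k) (D.e g x) = if g = 1 then 1 else 0 := D.counitLin_e g x

theorem comul_e_mul_e (g h : Γ) (x y : F) :
    Coalgebra.comul (R := k) (D.e g x * D.e h y) =
      Coalgebra.comul (R := k) (D.e g x) * Coalgebra.comul (R := k) (D.e h y) := by
  classical
  rw [e_mul_e, comul_e, comul_e]
  simp only [Finset.sum_mul, Finset.mul_sum, smul_mul_smul_comm,
    Algebra.TensorProduct.tmul_mul_tmul, e_mul_e, TensorProduct.ite_tmul, smul_ite, smul_zero]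
  rw [Finset.sum_comm]
  simp only [Finset.sum_ite_eq, Finset.mem_univ, if_true]
  have hc : ∀ s : Γ, D.ract (s⁻¹ * g) x = (D.ract s (D.act (s⁻¹ * g) x))⁻¹ * h ↔
      D.ract g x = h := by
    intro s
    rw [eq_inv_mul_iff_mul_eq, ← D.mul_ract, mul_inv_cancel_left]
  simp only [TensorProduct.tmul_ite, hc]
  split_ifs with h1
  · rw [map_smul, comul_e, Finset.smul_sum]
    refine Finset.sum_congr rfl fun s _ => ?_
    have h2 := (hc s).2 h1
    rw [← h2, TensorProduct.smul_tmul_smul, smul_smul, smul_smul]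
    have h3 : D.act (s⁻¹ * g) (x * y) =
        D.act (s⁻¹ * g) x * D.act (D.ract (s⁻¹ * g) x) y := D.act_mul _ _ _
    rw [h3]
    congr 1
    have h4 := D.compat s (s⁻¹ * g) x y
    rw [mul_inv_cancel_left] at h4
    exact_mod_cast h4
  · simp

theorem counit_e_mul_e (g h : Γ) (x y : F) :
    Coalgebra.counit (R := k) (D.e g x * D.e h y) =
      Coalgebra.counit (R := k) (D.e g x) * Coalgebra.counit (R := k) (D.e h y) := by
  classical
  rw [e_mul_e, counit_e, counit_e]
  by_cases hg : g = 1
  · subst hg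
    rw [D.one_ract]
    by_cases hh : h = 1
    · subst hh
      simp [counit_e, D.σ_at_one]
    · simp [hh, Ne.symm hh]
  · split_ifs <;> simp [counit_e, hg]

instance : Bialgebra k D.BicrossedProduct :=
  Bialgebra.mk' k D.BicrossedProduct
    (by
      classical
      simp [one_def, counit_e])
    (by
      intro a b
      have h : (LinearMap.mul k D.BicrossedProduct).compr₂ (Coalgebra.counit (R := k)) =
          (LinearMap.mul k k).compl₁₂ (Coalgebra.counit (R := k)) (Coalgebra.counit (R := k)) :=
        D.lin_ext fun g x => D.lin_ext fun h y => D.counit_e_mul_e g h x y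
      exact LinearMap.congr_fun (LinearMap.congr_fun h a) b)
    (by
      simp only [one_def, map_sum, comul_e, D.τ_at_one, D.act_one, Units.val_one, one_smul,
        Algebra.TensorProduct.one_def, TensorProduct.sum_tmul, TensorProduct.tmul_sum]
      rw [Finset.sum_comm]
      conv_rhs => rw [Finset.sum_comm]
      refine Finset.sum_congr rfl fun s _ => ?_
      exact Fintype.sum_equiv (Equiv.mulLeft s⁻¹) _ _ fun g => rfl)
    (by
      intro a b
      have h : (LinearMap.mul k D.BicrossedProduct).compr₂ (Coalgebra.comul (R := k)) =
          (LinearMap.mul k (D.BicrossedProduct ⊗[k] D.BicrossedProduct)).compl₁₂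
            (Coalgebra.comul (R := k)) (Coalgebra.comul (R := k)) :=
        D.lin_ext fun g x => D.lin_ext fun h y => D.comul_e_mul_e g h x y
      exact LinearMap.congr_fun (LinearMap.congr_fun h a) b)

theorem antipode_left_e (g : Γ) (x : F) :
    LinearMap.mul' k D.BicrossedProduct
      (D.antipodeLin.rTensor D.BicrossedProduct (Coalgebra.comul (R := k) (D.e g x))) =
      algebraMap k D.BicrossedProduct (Coalgebra.counit (R := k) (D.e g x)) := by
  classical
  have hc : ∀ s : Γ, D.ract (D.ract s (D.act (s⁻¹ * g) x))⁻¹ (D.act s (D.act (s⁻¹ * g) x))⁻¹ =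
      s⁻¹ * g ↔ g = 1 := by
    intro s
    rw [D.inv_ract_eq, ← D.ract_mul, mul_inv_cancel, D.ract_one, left_eq_mul]
  simp only [comul_e, map_sum, map_smul, LinearMap.rTensor_tmul, antipodeLin_e,
    LinearMap.mul'_apply, smul_mul_assoc, e_mul_e, hc, counit_e]
  split_ifs with h
  · subst h
    rw [map_one, one_def]
    have hinj : Function.Injective fun s : Γ => D.ract s⁻¹ x :=
      fun s t hst => inv_injective (D.ract_injective x hst)
    refine Fintype.sum_bijective _ (Finite.injective_iff_bijective.mp hinj) _ _ fun s => ?_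
    have h1 : D.act s (D.act s⁻¹ x) = x := D.act_inv_act s x
    have h2 : (D.ract s (D.act s⁻¹ x))⁻¹ = D.ract s⁻¹ x := by rw [D.inv_ract_eq, h1]
    have h3 := D.τ_inv s (D.act s⁻¹ x)
    rw [h1] at h3
    rw [mul_one, h1, h2, ← h3, smul_smul, smul_smul, inv_mul_cancel]
    simp only [← Units.val_mul]
    rw [show ∀ a b : kˣ, a * (b⁻¹ * a⁻¹) * b = 1 from fun a b => by
      rw [mul_comm b⁻¹, mul_inv_cancel_left, inv_mul_cancel], Units.val_one, one_smul]
  · simp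

theorem antipode_right_e (g : Γ) (x : F) :
    LinearMap.mul' k D.BicrossedProduct
      (D.antipodeLin.lTensor D.BicrossedProduct (Coalgebra.comul (R := k) (D.e g x))) =
      algebraMap k D.BicrossedProduct (Coalgebra.counit (R := k) (D.e g x)) := by
  classical
  have hc : ∀ s : Γ, D.ract s (D.act (s⁻¹ * g) x) = (D.ract (s⁻¹ * g) x)⁻¹ ↔ g = 1 := by
    intro s
    rw [eq_inv_iff_mul_eq_one, ← D.mul_ract, mul_inv_cancel_left]
    exact ⟨fun h => D.ract_injective x (h.trans (D.one_ract x).symm),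
      fun h => h ▸ D.one_ract x⟩
  simp only [comul_e, map_sum, map_smul, LinearMap.lTensor_tmul, antipodeLin_e,
    LinearMap.mul'_apply, mul_smul_comm, e_mul_e, hc, counit_e]
  split_ifs with h
  · subst h
    rw [map_one, one_def]
    refine Finset.sum_congr rfl fun s _ => ?_
    have h2 := (hc s).2 rfl
    rw [mul_one] at h2
    have h3 := D.σ_inv (D.act s⁻¹ x) s
    rw [h2] at h3
    rw [mul_one, inv_inv, h3, smul_smul, smul_smul, mul_inv_cancel]
    simp only [← Units.val_mul]
    rw [show ∀ a b : kˣ, a * (b⁻¹ * a⁻¹) * b = 1 from fun a b => by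
      rw [mul_comm b⁻¹, mul_inv_cancel_left, inv_mul_cancel], Units.val_one, one_smul]
  · simp

instance : HopfAlgebra k D.BicrossedProduct where
  antipode := D.antipodeLin
  mul_antipode_rTensor_comul := D.lin_ext fun g x => D.antipode_left_e g x
  mul_antipode_lTensor_comul := D.lin_ext fun g x => D.antipode_right_e g x

/-- The inclusion `k^Γ → k^Γ # kF`, `f ↦ f # 1 = ∑_g f(g) e_g # 1`, as an algebra map. -/
def functionsHom : (Γ → k) →ₐ[k] D.BicrossedProduct :=
  AlgHom.ofLinearMap
    { toFun := fun f : Γ → k => ∑ g : Γ, f g • D.e g 1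
      map_add' := fun f f' => by simp [add_smul, Finset.sum_add_distrib]
      map_smul' := fun r f => by simp [smul_smul, Finset.smul_sum] }
    (by simp [one_def])
    (by
      classical
      intro f f'
      simp [Finset.sum_mul, Finset.mul_sum, e_mul_e, smul_smul, D.ract_one, D.σ_one_left,
        mul_comm])

theorem functionsHom_apply (f : Γ → k) : D.functionsHom f = ∑ g : Γ, f g • D.e g 1 := rfl

end BicrossedData

end Bicrossed

end

open scoped TensorProduct

noncomputable section

/-! ### Magic corepresentations and quotients of `A_s(n)` -/

section MagicCorep

variable {k : Type*} [Field k]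

/-! A commutative left coideal subalgebra `C` of `H` that is spanned by orthogonal idempotents `p i`
with sum `1` carries a coaction of `H`. Writing `Δ (p i) = ∑ j, v i j ⊗ p j`, multiplicativity of
`Δ` gives the column relations for `v`, and coassociativity and the counit axiom make `v` a
corepresentation. If `S² = id`, the antipode transposes `v`, so the row relations follow from the
column ones. Hence `v` is a quotient image of the generators of `A_s(n)`, and its entries span a
space containing `C` (`exists_isMagicCorep`).

In the bicrossed product, centrality of `k^Γ` forces `◁` to be trivial (`ract_eq_of_central`), and
compatibility of the cocycles then gives `S² = id` (`antipode_antipode_of_ract_eq`). For each `x :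
F` of order `N`, the elements `e_g # x ^ m` span such a `C`. It is a left coideal because the right
leg of `Δ (e_g # y)` keeps `y`. Over an algebraically closed field, `1 # x` can be rescaled by an
element of `k^Γ` to some `X` with `X ^ N = 1`. Since `k^Γ` is central, the products of the `e_g # 1`
with the spectral idempotents of `X` give `|Γ| N` orthogonal idempotents spanning `C`
(`exists_isMagicCorep_of_central`).

The block sum of these matrices over all `x` generates `H` and has size `∑ x, |Γ| * orderOf x`,
which is at most `|Γ| |F|²`. -/

theorem LinearIndependent.exists_dual_family {M ι : Type*} [AddCommGroup M] [Module k M]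
    [DecidableEq ι] {p : ι → M} (hp : LinearIndependent k p) :
    ∃ f : ι → (M →ₗ[k] k), ∀ i j, f i (p j) = if i = j then 1 else 0 := by
  -- Over a field, the coordinates on the span of `p` extend to all of `M`.
  obtain ⟨g, hg⟩ := LinearMap.exists_extend hp.repr
  refine ⟨fun i => Finsupp.lapply i ∘ₗ g, fun i j => ?_⟩
  have h1 : g (p j) = Finsupp.single j 1 := by
    have h2 := LinearMap.congr_fun hg ⟨p j, Submodule.subset_span ⟨j, rfl⟩⟩
    rw [hp.repr_eq_single j _ rfl] at h2
    exact h2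
  rw [LinearMap.comp_apply, h1, Finsupp.lapply_apply, Finsupp.single_apply]
  simp only [eq_comm]

/-- Contracting the right leg with a dual family isolates each coefficient. This is how every
identity for a coaction matrix is read off from an identity for `Δ (p i)`. -/
theorem LinearIndependent.tmul_sum_injective {M N ι : Type*} [AddCommGroup M] [Module k M]
    [AddCommGroup N] [Module k N] [Fintype ι] {p : ι → N} (hp : LinearIndependent k p)
    {a b : ι → M} (h : ∑ i, a i ⊗ₜ[k] p i = ∑ i, b i ⊗ₜ[k] p i) : a = b := by
  classical
  obtain ⟨f, hf⟩ := hp.exists_dual_family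
  funext j
  have h1 := congrArg (fun z => TensorProduct.rid k M ((f j).lTensor M z)) h
  simpa [map_sum, hf] using h1

/-- A magic matrix in a Hopf algebra, which is moreover a corepresentation whose inverse is
its transpose. -/
structure IsMagicCorep (k : Type*) {H ι : Type*} [Field k] [Ring H] [HopfAlgebra k H]
    [Fintype ι] [DecidableEq ι] (v : Matrix ι ι H) : Prop where
  row_mul : ∀ i j l, v i j * v i l = if j = l then v i j else 0
  col_mul : ∀ i j l, v i j * v l j = if i = l then v i j else 0
  row_sum : ∀ i, ∑ l, v i l = 1
  col_sum : ∀ j, ∑ l, v l j = 1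
  comul : ∀ i j, Coalgebra.comul (R := k) (v i j) = ∑ l, v i l ⊗ₜ[k] v l j
  counit : ∀ i j, Coalgebra.counit (R := k) (v i j) = if i = j then 1 else 0
  antipode : ∀ i j, HopfAlgebra.antipode k (v i j) = v j i

variable {H : Type*} [Ring H] [HopfAlgebra k H]

namespace IsMagicCorep

theorem reindex {ι κ : Type*} [Fintype ι] [DecidableEq ι] [Fintype κ] [DecidableEq κ]
    {v : Matrix ι ι H} (hv : IsMagicCorep k v) (e : κ ≃ ι) :
    IsMagicCorep k (v.submatrix e e) where
  row_mul i j l := by simp [hv.row_mul]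
  col_mul i j l := by simp [hv.col_mul]
  row_sum i := (e.sum_comp fun l => v (e i) l).trans (hv.row_sum _)
  col_sum j := (e.sum_comp fun l => v l (e j)).trans (hv.col_sum _)
  comul i j := (hv.comul _ _).trans (e.sum_comp fun l => v (e i) l ⊗ₜ[k] v l (e j)).symm
  counit i j := by simp [hv.counit]
  antipode i j := hv.antipode _ _

/-- The block diagonal sum of a family of magic corepresentations. -/
theorem sigma {ι : Type*} [Fintype ι] [DecidableEq ι] {κ : ι → Type*} [∀ a, Fintype (κ a)]
    [∀ a, DecidableEq (κ a)] {v : ∀ a, Matrix (κ a) (κ a) H} (hv : ∀ a, IsMagicCorep k (v a)) :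
    IsMagicCorep k (Matrix.blockDiagonal' v) where
  row_mul := by
    rintro ⟨a, i⟩ ⟨b, j⟩ ⟨c, l⟩
    by_cases hb : a = b
    · subst hb
      by_cases hc : a = c
      · subst hc
        simp [(hv a).row_mul]
      · simp [Matrix.blockDiagonal'_apply_ne _ _ _ hc, hc]
    · rw [Matrix.blockDiagonal'_apply_ne _ _ _ hb]
      simp
  col_mul := by
    rintro ⟨a, i⟩ ⟨b, j⟩ ⟨c, l⟩
    by_cases hb : a = b
    · subst hb
      by_cases hc : a = c
      · subst hc
        simp [(hv a).col_mul]
      · simp [Matrix.blockDiagonal'_apply_ne _ _ _ (Ne.symm hc), hc]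
    · rw [Matrix.blockDiagonal'_apply_ne _ _ _ hb]
      simp
  row_sum := by
    rintro ⟨a, i⟩
    rw [Fintype.sum_sigma, Fintype.sum_eq_single a]
    · simp [(hv a).row_sum]
    · intro b hb
      simp [Matrix.blockDiagonal'_apply_ne _ _ _ (Ne.symm hb)]
  col_sum := by
    rintro ⟨a, i⟩
    rw [Fintype.sum_sigma, Fintype.sum_eq_single a]
    · simp [(hv a).col_sum]
    · intro b hb
      simp [Matrix.blockDiagonal'_apply_ne _ _ _ hb]
  comul := by
    rintro ⟨a, i⟩ ⟨b, j⟩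
    rw [Fintype.sum_sigma, Fintype.sum_eq_single a]
    · by_cases hb : a = b
      · subst hb
        simp [(hv a).comul]
      · simp [Matrix.blockDiagonal'_apply_ne _ _ _ hb]
    · intro c hc
      simp [Matrix.blockDiagonal'_apply_ne _ _ _ (Ne.symm hc)]
  counit := by
    rintro ⟨a, i⟩ ⟨b, j⟩
    by_cases hb : a = b
    · subst hb
      simp [(hv a).counit]
    · simp [Matrix.blockDiagonal'_apply_ne _ _ _ hb, hb]
  antipode := by
    rintro ⟨a, i⟩ ⟨b, j⟩
    by_cases hb : a = b
    · subst hb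
      simp [(hv a).antipode]
    · simp [Matrix.blockDiagonal'_apply_ne _ _ _ hb,
        Matrix.blockDiagonal'_apply_ne _ _ _ (Ne.symm hb)]

/-- If `H` is generated as an algebra by the entries of a magic corepresentation of size `n`,
then it is a quotient Hopf algebra of `A_s(n)`. -/
theorem isQuantumPermQuotient_fin {n : ℕ} {v : Matrix (Fin n) (Fin n) H} (hv : IsMagicCorep k v)
    (hgen : ∀ B : Subalgebra k H, (∀ i j, v i j ∈ B) → B = ⊤) :
    IsQuantumPermQuotient k H n := by
  let f : QuantumPerm k n →ₐ[k] H :=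
    QuantumPerm.lift v hv.row_mul hv.col_mul hv.row_sum hv.col_sum
  have hf : ∀ i j, f (QuantumPerm.u i j) = v i j := fun i j => QuantumPerm.lift_u _ _ _ _ _ i j
  have hcounit : (Bialgebra.counitAlgHom k H).comp f =
      Bialgebra.counitAlgHom k (QuantumPerm k n) := by
    refine QuantumPerm.algHom_ext fun i j => ?_
    rw [AlgHom.comp_apply, hf]
    exact (hv.counit i j).trans (QuantumPerm.counitHom_u i j).symm
  have hcomul : (Algebra.TensorProduct.map f f).comp (Bialgebra.comulAlgHom k _) =
      (Bialgebra.comulAlgHom k H).comp f := by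
    refine QuantumPerm.algHom_ext fun i j => ?_
    rw [AlgHom.comp_apply, AlgHom.comp_apply, hf]
    refine Eq.trans ?_ (hv.comul i j).symm
    refine (congrArg (Algebra.TensorProduct.map f f) (QuantumPerm.comulHom_u i j)).trans ?_
    simp [hf]
  refine ⟨BialgHom.ofAlgHom f hcounit hcomul, ?_, fun a => ?_⟩
  · have h := hgen f.range fun i j => ⟨_, hf i j⟩
    exact (AlgHom.range_eq_top f).1 h
  · change f (HopfAlgebra.antipode k a) = HopfAlgebra.antipode k (f a)
    -- Both sides are linear and antimultiplicative in `a`, so only generators matter.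
    induction a using QuantumPerm.induct with
    | halg r =>
      rw [Algebra.algebraMap_eq_smul_one, map_smul, HopfAlgebra.antipode_one, map_smul, map_one,
        map_smul, HopfAlgebra.antipode_one]
    | hu i j =>
      rw [hf, hv.antipode, ← hf]
      exact congrArg f (QuantumPerm.antipodeLin_u i j)
    | hadd a b ha hb => simp only [map_add, ha, hb]
    | hmul a b ha hb =>
      simp only [HopfAlgebra.antipode_mul_antidistrib, map_mul, ha, hb]

theorem isQuantumPermQuotient {ι : Type*} [Fintype ι] [DecidableEq ι] {v : Matrix ι ι H}
    (hv : IsMagicCorep k v) (hgen : ∀ B : Subalgebra k H, (∀ i j, v i j ∈ B) → B = ⊤) :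
    IsQuantumPermQuotient k H (Fintype.card ι) := by
  let e := Fintype.equivFin ι
  refine (hv.reindex e.symm).isQuantumPermQuotient_fin fun B hB => hgen B fun i j => ?_
  simpa using hB (e i) (e j)

end IsMagicCorep

/-- In a Hopf algebra with involutive antipode, a basis of orthogonal idempotents of a
commutative left coideal subalgebra gives rise to a magic corepresentation, whose entries
span a subspace that contains the coideal subalgebra. -/
theorem exists_isMagicCorep {ι : Type*} [Fintype ι] [DecidableEq ι]
    (hS : ∀ a : H, HopfAlgebra.antipode k (HopfAlgebra.antipode k a) = a) {p : ι → H}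
    (hp : LinearIndependent k p) (hmul : ∀ i j, p i * p j = if i = j then p i else 0)
    (hsum : ∑ i, p i = 1)
    (hcoideal : ∀ i, ∃ w : ι → H, Coalgebra.comul (R := k) (p i) = ∑ j, w j ⊗ₜ[k] p j) :
    ∃ v : Matrix ι ι H, IsMagicCorep k v ∧
      ∀ i, p i ∈ Submodule.span k (Set.range fun q : ι × ι => v q.1 q.2) := by
  choose v hv using hcoideal
  have hcol : ∀ i j l, v i j * v l j = if i = l then v i j else 0 := by
    intro i j l
    -- Orthogonality of the right legs leaves only the diagonal terms of `Δ (p i) * Δ (p l)`.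
    have h : Coalgebra.comul (R := k) (p i * p l) = ∑ j, (v i j * v l j) ⊗ₜ[k] p j := by
      rw [Bialgebra.comul_mul, hv, hv]
      simp [Finset.sum_mul, Finset.mul_sum, hmul, TensorProduct.tmul_ite]
    rw [hmul] at h
    have h2 := hp.tmul_sum_injective
      (a := fun j => if i = l then v i j else 0) (b := fun j => v i j * v l j) (by
        rw [← h]
        split_ifs <;> simp [hv])
    exact (congrFun h2 j).symm
  have hcolsum : ∀ j, ∑ l, v l j = 1 := by
    intro j
    have h : Coalgebra.comul (R := k) (∑ i, p i) = ∑ j, (∑ i, v i j) ⊗ₜ[k] p j := by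
      simp only [map_sum, hv, TensorProduct.sum_tmul]
      exact Finset.sum_comm
    rw [hsum, Bialgebra.comul_one, Algebra.TensorProduct.one_def, ← hsum,
      TensorProduct.tmul_sum, hsum] at h
    exact (congrFun (hp.tmul_sum_injective h) j).symm
  have hcomul : ∀ i j, Coalgebra.comul (R := k) (v i j) = ∑ l, v i l ⊗ₜ[k] v l j := by
    intro i j
    -- Compare the coefficients of `p j` in the last leg of coassociativity.
    have h := Coalgebra.coassoc_symm_apply (R := k) (p i)
    simp only [hv, map_sum, LinearMap.lTensor_tmul, LinearMap.rTensor_tmul,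
      TensorProduct.tmul_sum, TensorProduct.assoc_symm_tmul] at h
    rw [Finset.sum_comm] at h
    simp only [← TensorProduct.sum_tmul] at h
    exact (congrFun (hp.tmul_sum_injective h) j).symm
  have hcounit : ∀ i j, Coalgebra.counit (R := k) (v i j) = if i = j then 1 else 0 := by
    intro i j
    have h := Coalgebra.rTensor_counit_comul (R := k) (p i)
    rw [hv, map_sum] at h
    simp only [LinearMap.rTensor_tmul] at h
    have h2 := hp.tmul_sum_injective (a := fun j => Coalgebra.counit (R := k) (v i j))
      (b := fun j => if i = j then (1 : k) else 0) (by
        rw [h]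
        simp [TensorProduct.ite_tmul])
    exact congrFun h2 j
  -- The antipode axiom at `v i i` reads `∑ l, S (v i l) * v l i = 1`. Multiplying on the right by
  -- `v m i` leaves only `l = m`, by column orthogonality.
  have hSv : ∀ i m, HopfAlgebra.antipode k (v i m) * v m i = v m i := by
    intro i m
    have h := HopfAlgebra.mul_antipode_rTensor_comul_apply (R := k) (v i i)
    rw [hcomul, hcounit, if_pos rfl, map_one] at h
    simp only [map_sum, LinearMap.rTensor_tmul, LinearMap.mul'_apply] at h
    have h2 := congrArg (· * v m i) h
    simpa only [Finset.sum_mul, mul_assoc, hcol, mul_ite, mul_zero, Finset.sum_ite_eq',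
      Finset.mem_univ, if_true, one_mul] using h2
  -- Applying `S` to `S (v m i) * v i m = v i m` turns its left side into `S (v i m) * v m i`,
  -- because `S² = id`. By `hSv` this is `v m i`.
  have hSS : ∀ i m, HopfAlgebra.antipode k (v i m) = v m i := by
    intro i m
    have h := congrArg (HopfAlgebra.antipode k) (hSv m i)
    rw [HopfAlgebra.antipode_mul_antidistrib, hS, hSv] at h
    exact h.symm
  have hrow : ∀ i j l, v i j * v i l = if j = l then v i j else 0 := by
    intro i j l
    have h := congrArg (HopfAlgebra.antipode k) (hcol l i j)
    rw [HopfAlgebra.antipode_mul_antidistrib, hSS, hSS] at h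
    rw [h]
    rcases eq_or_ne j l with rfl | hjl
    · simp [hSS]
    · simp [hjl, hjl.symm]
  have hrowsum : ∀ i, ∑ l, v i l = 1 := by
    intro i
    have h := congrArg (HopfAlgebra.antipode k) (hcolsum i)
    simpa only [map_sum, hSS, HopfAlgebra.antipode_one] using h
  refine ⟨v, ⟨hrow, hcol, hrowsum, hcolsum, hcomul, hcounit, hSS⟩, fun i => ?_⟩
  -- Applying the counit to the right leg gives `p i = ∑ j, ε (p j) • v i j`.
  have h := congrArg (TensorProduct.rid k H) (Coalgebra.lTensor_counit_comul (R := k) (p i))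
  simp only [hv, map_sum, LinearMap.lTensor_tmul, TensorProduct.rid_tmul, one_smul] at h
  rw [← h]
  exact Submodule.sum_mem _ fun j _ => Submodule.smul_mem _ _ (Submodule.subset_span ⟨(i, j), rfl⟩)

end MagicCorep

/-! ### Spectral idempotents of an element of finite order -/

section CyclicIdempotents

variable {k A : Type*} [Field k] [Ring A] [Algebra k A] {N : ℕ}

/-- The spectral idempotents of an element of finite order: `X ^ m` is the sum over the
`N`-th roots of unity `ζ ^ j` of `ζ ^ (j * m)` times the `j`-th idempotent. -/
theorem exists_spectral_idempotents {ζ : k} (hζ : IsPrimitiveRoot ζ N) (hN : (N : k) ≠ 0)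
    {X : A} (hX : X ^ N = 1) :
    ∃ P : Fin N → A, (∀ i j, P i * P j = if i = j then P i else 0) ∧ ∑ j, P j = 1 ∧
      (∀ m : ℕ, X ^ m = ∑ j : Fin N, (ζ ^ (j : ℕ)) ^ m • P j) ∧
      ∀ j, P j = (N : k)⁻¹ • ∑ m ∈ Finset.range N, (ζ⁻¹ ^ (j : ℕ)) ^ m • X ^ m := by
  have hN0 : N ≠ 0 := by
    rintro rfl
    simp at hN
  have hζ0 : ζ ≠ 0 := hζ.ne_zero hN0
  have hgeom : ∀ w : k, w ^ N = 1 → w ≠ 1 → ∑ m ∈ Finset.range N, w ^ m = 0 := by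
    intro w h1 h2
    have h := geom_sum_mul w N
    rw [h1, sub_self] at h
    exact (mul_eq_zero.mp h).resolve_right (sub_ne_zero.mpr h2)
  let P : Fin N → A := fun j =>
    (N : k)⁻¹ • ∑ m ∈ Finset.range N, (ζ⁻¹ ^ (j : ℕ)) ^ m • X ^ m
  -- `P j` is a multiple of the geometric sum of `ζ⁻ʲ X`. As the `N`-th power of `ζ⁻ʲ X` is `1`,
  -- that sum is fixed under multiplication by `ζ⁻ʲ X`.
  have hXP : ∀ j, X * P j = ζ ^ (j : ℕ) • P j := by
    intro j
    have h := mul_geom_sum (ζ⁻¹ ^ (j : ℕ) • X) N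
    have h1 : (ζ⁻¹ ^ (j : ℕ) • X) ^ N = 1 := by
      rw [smul_pow, hX, ← pow_mul, mul_comm, pow_mul, inv_pow, hζ.pow_eq_one, inv_one, one_pow,
        one_smul]
    rw [h1, sub_self, sub_mul, one_mul, sub_eq_zero] at h
    simp only [smul_pow] at h
    have h2 : ∀ a : A, X * a = ζ ^ (j : ℕ) • (ζ⁻¹ ^ (j : ℕ) • X * a) := by
      intro a
      rw [smul_mul_assoc, smul_smul, ← mul_pow, mul_inv_cancel₀ hζ0, one_pow, one_smul]
    simp only [P]
    rw [mul_smul_comm, h2, h, smul_comm]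
  have hXmP : ∀ (m : ℕ) j, X ^ m * P j = (ζ ^ (j : ℕ)) ^ m • P j := by
    intro m j
    induction m with
    | zero => simp
    | succ m ih => rw [pow_succ, mul_assoc, hXP, mul_smul_comm, ih, smul_smul, pow_succ, mul_comm]
  have hsum : ∑ j, P j = 1 := by
    simp only [P]
    rw [← Finset.smul_sum, Finset.sum_comm]
    -- For `0 < m < N`, the scalars form a full geometric sum of `ζ⁻ᵐ ≠ 1`, which vanishes.
    have h : ∀ m ∈ Finset.range N, ∑ j : Fin N, (ζ⁻¹ ^ (j : ℕ)) ^ m • X ^ m =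
        if m = 0 then (N : k) • 1 else 0 := by
      intro m hm
      rw [← Finset.sum_smul]
      split_ifs with h0
      · subst h0
        simp
      · have h1 : ∑ j : Fin N, (ζ⁻¹ ^ (j : ℕ)) ^ m = 0 := by
          rw [Fin.sum_univ_eq_sum_range (fun j => (ζ⁻¹ ^ j) ^ m)]
          simp only [← pow_mul, mul_comm _ m]
          simp only [pow_mul]
          refine hgeom _ ?_ fun h => ?_
          · rw [← pow_mul, mul_comm, pow_mul, inv_pow, hζ.pow_eq_one, inv_one, one_pow]
          · rw [inv_pow, inv_eq_one] at h
            exact hζ.pow_ne_one_of_pos_of_lt h0 (Finset.mem_range.mp hm) h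
        rw [h1, zero_smul]
    rw [Finset.sum_congr rfl h, Finset.sum_ite_eq', if_pos (Finset.mem_range.mpr (by omega)),
      smul_smul, inv_mul_cancel₀ hN, one_smul]
  refine ⟨P, fun i j => ?_, hsum, fun m => ?_, fun j => rfl⟩
  -- Only the left factor is expanded. Since `P j` is an eigenvector of `X`, the product is `P j`
  -- times the average of the powers of `ζ⁻ⁱ ζʲ`, which is `1` if `i = j` and `0` otherwise.
  · conv_lhs => rw [show P i = (N : k)⁻¹ • ∑ m ∈ Finset.range N, (ζ⁻¹ ^ (i : ℕ)) ^ m • X ^ m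
      from rfl]
    rw [smul_mul_assoc, Finset.sum_mul]
    simp only [smul_mul_assoc, hXmP, smul_smul, ← mul_pow]
    rw [← Finset.sum_smul]
    split_ifs with hij
    · subst hij
      rw [← mul_pow, inv_mul_cancel₀ hζ0]
      simp [smul_smul, inv_mul_cancel₀ hN]
    · rw [hgeom, zero_smul, smul_zero]
      · rw [mul_pow, ← pow_mul, ← pow_mul, mul_comm _ N, mul_comm _ N, pow_mul, pow_mul, inv_pow,
          hζ.pow_eq_one]
        simp
      · intro h
        rw [inv_pow] at h
        have h1 : ζ ^ (i : ℕ) = ζ ^ (j : ℕ) := by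
          rw [inv_mul_eq_one₀ (pow_ne_zero _ hζ0)] at h
          exact h
        exact hij (Fin.ext (hζ.pow_inj i.2 j.2 h1))
  · rw [← mul_one (X ^ m), ← hsum, Finset.mul_sum]
    exact Finset.sum_congr rfl fun j _ => hXmP m j

theorem linearIndependent_of_orthogonal_idempotents {ι : Type*} [Fintype ι] [DecidableEq ι]
    {p : ι → A} (hmul : ∀ i j, p i * p j = if i = j then p i else 0) (hne : ∀ i, p i ≠ 0) :
    LinearIndependent k p := by
  rw [Fintype.linearIndependent_iff]
  intro a ha i
  have h := congrArg (· * p i) ha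
  simp only [Finset.sum_mul, smul_mul_assoc, hmul, smul_ite, smul_zero, Finset.sum_ite_eq',
    Finset.mem_univ, if_true, zero_mul] at h
  exact (smul_eq_zero.mp h).resolve_right (hne i)

end CyclicIdempotents

/-! ### Coideal subalgebras of a bicrossed product with central `k^Γ` -/

namespace BicrossedData

variable {k F Γ : Type*} [Field k] [Group F] [Group Γ] (D : BicrossedData k F Γ) [Fintype Γ]

theorem functionsHom_single [DecidableEq Γ] (g : Γ) :
    D.functionsHom (Pi.single g 1) = D.e g 1 := by
  rw [functionsHom_apply, Fintype.sum_eq_single g]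
  · simp
  · intro h hh
    simp [Pi.single_eq_of_ne hh]

theorem e_mul_sum_e (g : Γ) (x y : F) :
    D.e g x * ∑ h, D.e h y = (D.σ x y g : k) • D.e g (x * y) := by
  classical
  simp [Finset.mul_sum, e_mul_e]

theorem e_one_mul_functionsHom (f : Γ → k) (g : Γ) :
    D.e g 1 * D.functionsHom f = f g • D.e g 1 := by
  classical
  simp [functionsHom_apply, Finset.mul_sum, e_mul_e, D.ract_one, D.σ_one_right]

theorem e_ne_zero (g : Γ) (x : F) : D.e g x ≠ 0 := D.basis.ne_zero _

theorem subalgebra_eq_top {B : Subalgebra k D.BicrossedProduct} (h : ∀ g x, D.e g x ∈ B) :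
    B = ⊤ := by
  rw [← Algebra.toSubmodule_eq_top, eq_top_iff, ← D.basis.span_eq, Submodule.span_le]
  rintro _ ⟨p, rfl⟩
  exact h p.1 p.2

variable {D}

/-- Multiplying `e_g # x` by `e_g # 1` on the left gives `e_g # x ≠ 0`, while multiplying on the
right gives zero unless `g ◁ x = g`. -/
theorem ract_eq_of_central (hD : D.functionsHom.range ≤ Subalgebra.center k D.BicrossedProduct)
    (g : Γ) (x : F) : D.ract g x = g := by
  classical
  have h1 : D.e g 1 ∈ Subalgebra.center k D.BicrossedProduct :=
    hD ⟨_, D.functionsHom_single g⟩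
  have h2 := Subalgebra.mem_center_iff.mp h1 (D.e g x)
  rw [e_mul_e, e_mul_e, D.ract_one, if_pos rfl, D.σ_one_left, one_mul, Units.val_one,
    one_smul] at h2
  by_contra h
  rw [if_neg h] at h2
  exact D.e_ne_zero g x h2.symm

/-- With `◁` trivial, `Γ` acts on `F` by group automorphisms, so `S²` sends each `e_g # x` to a
scalar multiple of itself. The compatibility condition makes the scalar `1`. -/
theorem antipode_antipode_of_ract_eq (hr : ∀ g x, D.ract g x = g) (a : D.BicrossedProduct) :
    HopfAlgebra.antipode k (HopfAlgebra.antipode k a) = a := by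
  suffices h : D.antipodeLin ∘ₗ D.antipodeLin = LinearMap.id from LinearMap.congr_fun h a
  refine D.lin_ext fun g x => ?_
  have hact : D.act g⁻¹ (D.act g x)⁻¹ = x⁻¹ := by
    have h := D.inv_act_eq g⁻¹ (D.act g x)
    rw [D.inv_act_act, hr] at h
    exact h.symm
  rw [LinearMap.comp_apply, antipodeLin_e, map_smul, antipodeLin_e, smul_smul]
  simp only [hr, hact, inv_inv, LinearMap.id_apply, ← Units.val_mul]
  -- Here `s t = 1` and `x y = 1`, so the left side of the condition is trivial. The right side is,
  -- up to `τ_inv` and `σ_inv`, the inverse of the scalar of `S²`.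
  have h1 := D.compat g⁻¹ g x x⁻¹
  have h2 : D.act g x⁻¹ = (D.act g x)⁻¹ := by rw [D.inv_act_eq, hr]
  rw [hr, hr, inv_mul_cancel, mul_inv_cancel, D.σ_at_one, D.τ_at_one, h2, one_mul] at h1
  have h3 := D.τ_inv g x⁻¹
  rw [h2] at h3
  have h5 := D.σ_inv (D.act g x) g⁻¹
  rw [hr] at h5
  rw [h3, h5]
  convert one_smul k (D.e g x)
  rw [Units.val_eq_one, ← inv_inj, inv_one, h1]
  simp only [mul_inv, inv_inv]
  ac_rfl

/-- A suitable rescaling of `1 # x` is an invertible element of order dividing the order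
of `x`. -/
theorem exists_pow_orderOf_eq_one [IsAlgClosed k]
    (hD : D.functionsHom.range ≤ Subalgebra.center k D.BicrossedProduct) {x : F}
    (hx : IsOfFinOrder x) :
    ∃ (X : D.BicrossedProduct) (c : Γ → ℕ → kˣ), X ^ orderOf x = 1 ∧
      ∀ g m, D.e g 1 * X ^ m = (c g m : k) • D.e g (x ^ m) := by
  -- `Y` is `1 # x`. Its powers differ from `1 # x ^ m` by a unit on each component `e_g`.
  set Y : D.BicrossedProduct := ∑ h, D.e h x
  have hY : ∀ g (m : ℕ), ∃ c : kˣ, D.e g 1 * Y ^ m = (c : k) • D.e g (x ^ m) := by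
    intro g m
    induction m with
    | zero => exact ⟨1, by simp⟩
    | succ m ih =>
      obtain ⟨c, hc⟩ := ih
      refine ⟨c * D.σ (x ^ m) x g, ?_⟩
      rw [pow_succ, ← mul_assoc, hc, smul_mul_assoc, e_mul_sum_e, smul_smul, ← pow_succ,
        Units.val_mul]
  choose c hc using hY
  have hpos : 0 < orderOf x := hx.orderOf_pos
  -- As `x ^ orderOf x = 1`, the power `Y ^ orderOf x` acts on `e_g # 1` as the scalar `c g (orderOf
  -- x)`. An `orderOf x`-th root of its inverse rescales this to `1`, because elements of `k^Γ`
  -- commute with `Y`.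
  have hroot : ∀ g, ∃ l : k, l ^ orderOf x = ((c g (orderOf x))⁻¹ : kˣ) := fun g =>
    IsAlgClosed.exists_pow_nat_eq _ hpos
  choose l hl using hroot
  have hl0 : ∀ g, l g ≠ 0 := by
    intro g h
    have h1 := hl g
    rw [h, zero_pow hpos.ne'] at h1
    exact Units.ne_zero _ h1.symm
  have hcomm : Commute (D.functionsHom l) Y :=
    (Subalgebra.mem_center_iff.mp (hD ⟨l, rfl⟩) Y).symm
  have hpow : ∀ g m, D.e g 1 * (D.functionsHom l * Y) ^ m =
      (l g ^ m * (c g m : k)) • D.e g (x ^ m) := by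
    intro g m
    rw [hcomm.mul_pow, ← mul_assoc, ← map_pow, e_one_mul_functionsHom, smul_mul_assoc, hc,
      smul_smul, Pi.pow_apply]
  refine ⟨D.functionsHom l * Y, fun g m => Units.mk0 (l g) (hl0 g) ^ m * c g m, ?_, fun g m => ?_⟩
  · rw [← one_mul ((D.functionsHom l * Y) ^ orderOf x), one_def, Finset.sum_mul]
    refine Finset.sum_congr rfl fun g _ => ?_
    rw [hpow, hl, Units.inv_mul, one_smul, pow_orderOf_eq_one]
  · rw [hpow]
    simp

/-- If `k^Γ` is central, then for every `x` the span of the elements `e_g # x ^ m` is a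
commutative coideal subalgebra, which yields a magic corepresentation of size
`|Γ| * orderOf x`. -/
theorem exists_isMagicCorep_of_central [DecidableEq Γ] [IsAlgClosed k] [CharZero k]
    (hD : D.functionsHom.range ≤ Subalgebra.center k D.BicrossedProduct) {x : F}
    (hx : IsOfFinOrder x) :
    ∃ v : Matrix (Γ × Fin (orderOf x)) (Γ × Fin (orderOf x)) D.BicrossedProduct,
      IsMagicCorep k v ∧
        ∀ g, D.e g x ∈ Submodule.span k
          (Set.range fun q : (Γ × Fin (orderOf x)) × (Γ × Fin (orderOf x)) => v q.1 q.2) := by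
  classical
  have hr := ract_eq_of_central hD
  obtain ⟨X, c, hX, hc⟩ := exists_pow_orderOf_eq_one hD hx
  have hpos : 0 < orderOf x := hx.orderOf_pos
  have hN : (orderOf x : k) ≠ 0 := Nat.cast_ne_zero.mpr hpos.ne'
  have : NeZero (orderOf x : k) := ⟨hN⟩
  obtain ⟨ζ, hζ⟩ := HasEnoughRootsOfUnity.exists_primitiveRoot k (orderOf x)
  obtain ⟨P, hPP, hPsum, hXP, hP⟩ := exists_spectral_idempotents hζ hN hX
  have hcent : ∀ g (a : D.BicrossedProduct), a * D.e g 1 = D.e g 1 * a := fun g a =>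
    Subalgebra.mem_center_iff.mp (hD ⟨_, D.functionsHom_single g⟩) a
  let p : Γ × Fin (orderOf x) → D.BicrossedProduct := fun i => D.e i.1 1 * P i.2
  have hmul : ∀ i j, p i * p j = if i = j then p i else 0 := by
    rintro ⟨g, i⟩ ⟨h, j⟩
    have h1 : p (g, i) * p (h, j) = D.e g 1 * D.e h 1 * (P i * P j) := by
      simp only [p]
      rw [mul_assoc, ← mul_assoc (P i), hcent, mul_assoc, mul_assoc]
    rw [h1, hPP, e_mul_e, D.ract_one, mul_one, D.σ_one_left, Units.val_one, one_smul]
    simp only [Prod.mk.injEq, ite_mul, mul_ite, zero_mul, mul_zero, ite_and, p]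
    split_ifs <;> rfl
  have hsum : ∑ i, p i = 1 := by
    simp only [p]
    rw [Fintype.sum_prod_type]
    simp only [← Finset.mul_sum, hPsum, mul_one]
    rfl
  have hpe : ∀ g j, p (g, j) = (orderOf x : k)⁻¹ • ∑ m ∈ Finset.range (orderOf x),
      ((ζ⁻¹ ^ (j : ℕ)) ^ m * (c g m : k)) • D.e g (x ^ m) := by
    intro g j
    simp only [p, hP, mul_smul_comm, Finset.mul_sum, hc, smul_smul]
  -- The coefficient of `e_g # 1` comes from `m = 0` alone, where it is a unit, since `x ^ m ≠ 1`
  -- for `0 < m < orderOf x`.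
  have hne : ∀ i, p i ≠ 0 := by
    rintro ⟨g, j⟩ h
    rw [hpe] at h
    have h1 := congrArg (D.basis.coord (g, 1)) ((smul_eq_zero.mp h).resolve_left (inv_ne_zero hN))
    rw [map_sum, map_zero, Finset.sum_eq_single 0] at h1
    · simp [e] at h1
    · intro m hm hm0
      have hxm : x ^ m ≠ 1 := pow_ne_one_of_lt_orderOf hm0 (Finset.mem_range.mp hm)
      simp [e, hxm]
    · intro h0
      exact absurd (Finset.mem_range.mpr hpos) h0
  -- Up to a unit, `e_g # x ^ m` is `e_g X ^ m`, which expands in the spectral idempotents.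
  have hspan : ∀ g m, D.e g (x ^ m) ∈ Submodule.span k (Set.range p) := by
    intro g m
    have h : D.e g (x ^ m) = ((c g m)⁻¹ : kˣ) • (D.e g 1 * X ^ m) := by
      rw [hc, Units.smul_def, smul_smul, Units.inv_mul, one_smul]
    rw [h, hXP, Finset.mul_sum, Units.smul_def]
    refine Submodule.smul_mem _ _ (Submodule.sum_mem _ fun j _ => ?_)
    rw [mul_smul_comm]
    exact Submodule.smul_mem _ _ (Submodule.subset_span ⟨(g, j), rfl⟩)
  -- The range of `T` consists of the tensors with right leg in the span of `p`. Membership in it is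
  -- stable under linear combinations, so `Δ` can be checked on the `e_g # x ^ m`.
  let T : (Γ × Fin (orderOf x) → D.BicrossedProduct) →ₗ[k]
      D.BicrossedProduct ⊗[k] D.BicrossedProduct :=
    ∑ i, (TensorProduct.mk k _ _).flip (p i) ∘ₗ LinearMap.proj i
  have hT : ∀ w, T w = ∑ i, w i ⊗ₜ[k] p i := by
    intro w
    simp [T]
  have htmul : ∀ a, ∀ z ∈ Submodule.span k (Set.range p), a ⊗ₜ[k] z ∈ LinearMap.range T := by
    intro a z hz
    suffices h : Submodule.span k (Set.range p) ≤
        (LinearMap.range T).comap (TensorProduct.mk k _ _ a) from h hz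
    rw [Submodule.span_le]
    rintro _ ⟨i, rfl⟩
    refine ⟨Pi.single i a, ?_⟩
    rw [hT, Fintype.sum_eq_single i]
    · simp
    · intro j hj
      simp [Pi.single_eq_of_ne hj]
  have hcoideal : ∀ i, ∃ w : Γ × Fin (orderOf x) → D.BicrossedProduct,
      Coalgebra.comul (R := k) (p i) = ∑ j, w j ⊗ₜ[k] p j := by
    rintro ⟨g, j⟩
    have h : Coalgebra.comul (R := k) (p (g, j)) ∈ LinearMap.range T := by
      rw [hpe, map_smul, map_sum]
      refine Submodule.smul_mem _ _ (Submodule.sum_mem _ fun m _ => ?_)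
      rw [map_smul, comul_e]
      exact Submodule.smul_mem _ _ (Submodule.sum_mem _ fun s _ =>
        Submodule.smul_mem _ _ (htmul _ _ (hspan _ _)))
    obtain ⟨w, hw⟩ := h
    exact ⟨w, by rw [← hw, hT]⟩
  obtain ⟨v, hv, hpv⟩ := exists_isMagicCorep (antipode_antipode_of_ract_eq hr)
    (linearIndependent_of_orthogonal_idempotents hmul hne) hmul hsum hcoideal
  refine ⟨v, hv, fun g => ?_⟩
  -- The idempotents span all `e_g # x ^ m`. The case `m = 1` suffices, since every `x : F` gets its
  -- own block.
  have h := hspan g 1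
  rw [pow_one] at h
  refine (Submodule.span_le.mpr ?_ : Submodule.span k (Set.range p) ≤ _) h
  rintro _ ⟨i, rfl⟩
  exact hpv i

theorem isQuantumPermQuotient_of_central [Fintype F] [IsAlgClosed k] [CharZero k]
    (hD : D.functionsHom.range ≤ Subalgebra.center k D.BicrossedProduct) :
    IsQuantumPermQuotient k D.BicrossedProduct (∑ x : F, Fintype.card Γ * orderOf x) := by
  classical
  choose v hv hev using fun x : F => exists_isMagicCorep_of_central hD (isOfFinOrder_of_finite x)
  have h := (IsMagicCorep.sigma hv).isQuantumPermQuotient fun B hB =>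
    D.subalgebra_eq_top fun g x => by
      refine (Submodule.span_le.mpr ?_ :
        Submodule.span k _ ≤ Subalgebra.toSubmodule B) (hev x g)
      rintro _ ⟨q, rfl⟩
      have h1 := hB ⟨x, q.1⟩ ⟨x, q.2⟩
      rwa [Matrix.blockDiagonal'_apply_eq] at h1
  simpa [Fintype.card_sigma] using h

end BicrossedData

end

/-! ### The degree bound -/

theorem theorem5p1 {k F Γ : Type*} [Field k] [IsAlgClosed k] [CharZero k]
    [Group F] [Fintype F] [Group Γ] [Fintype Γ] (D : BicrossedData k F Γ)
    (hcentral : D.functionsHom.range ≤ Subalgebra.center k D.BicrossedProduct) :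
    IsQuantumPermutationAlgebra k D.BicrossedProduct ∧
      quantumDegree k D.BicrossedProduct ≤ Fintype.card Γ * Fintype.card F ^ 2 := by
  have h := BicrossedData.isQuantumPermQuotient_of_central hcentral
  -- The summand at `x = 1` is already `|Γ| ≥ 1`.
  have h1 : 1 ≤ ∑ x : F, Fintype.card Γ * orderOf x := by
    refine le_trans ?_ (Finset.single_le_sum (fun _ _ => Nat.zero_le _) (Finset.mem_univ (1 : F)))
    rw [orderOf_one, mul_one]
    exact Fintype.card_pos
  have hdeg : quantumDegree k D.BicrossedProduct ≤ ∑ x : F, Fintype.card Γ * orderOf x :=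
    Nat.sInf_le ⟨h1, h⟩
  refine ⟨⟨_, h1, h⟩, hdeg.trans ?_⟩
  calc ∑ x : F, Fintype.card Γ * orderOf x
      ≤ ∑ _x : F, Fintype.card Γ * Fintype.card F :=
        Finset.sum_le_sum fun x _ => Nat.mul_le_mul_left _ orderOf_le_card_univ
    _ = Fintype.card Γ * Fintype.card F ^ 2 := by
        rw [Finset.sum_const, Finset.card_univ, smul_eq_mul]
        ring
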